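/- Let $K\ge 0$ be an integer. Consider observations $(\mathbf{x}_n,y_n)\in\mathbb{R}^K\times\mathbb{R}$, $n=1,2,\dots$, and write $\mathbf{z}_n:=(1,\mathbf{x}_n)\in\mathbb{R}^{K+1}$ (a column vector); for $l\ge 1$ let $\mathbf{Z}_l$ be the $l\times(K+1)$ matrix with rows $\mathbf{z}_1',\dots,\mathbf{z}_l'$, and let $\mathbf{y}_l:=(y_1,\dots,y_l)'$. The Gauss linear model is the set of the laws of all sequences of observations such that $$y_n=\alpha+\boldsymbol\beta\cdot\mathbf{x}_n+\xi_n,\qquad n=1,2,\dots,$$ where $\alpha\in\mathbb{R}$, $\boldsymbol\beta\in\mathbb{R}^K$ and $\sigma^2>0$ are arbitrary constants, the noise variables $\xi_1,\xi_2,\dots$ are independent with the distribution $N(0,\sigma^2)$, and the explanatory vectors $\mathbf{x}_1,\mathbf{x}_2,\dots$ are deterministic (or, more generally, form a random sequence with an arbitrary distribution, independent of $(\xi_n)$) and are such that (almost surely) $\operatorname{rank}\mathbf{Z}_l=\min(l,K+1)$ for all $l$. For $l\ge K+1$ let $\hat{\boldsymbol\gamma}_l:=(\mathbf{Z}_l'\mathbf{Z}_l)^{-1}\mathbf{Z}_l'\mathbf{y}_l$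 be the least-squares estimate, and for $l\ge K+2$ let $$\hat\sigma_l^2:=\frac{1}{l-K-1}(\mathbf{y}_l-\mathbf{Z}_l\hat{\boldsymbol\gamma}_l)'(\mathbf{y}_l-\mathbf{Z}_l\hat{\boldsymbol\gamma}_l).$$ Let $\hat y_n:=\hat{\boldsymbol\gamma}_{n-1}\cdot\mathbf{z}_n$, and let $t_m^\delta$ be the upper $\delta$ point of the $t$-distribution with $m$ degrees of freedom. The classical predictor outputs, for each $\varepsilon\in(0,1)$, $$\Gamma_n^\varepsilon:=\Bigl\{y\in\mathbb{R}:|y-\hat y_n|<t_{n-K-2}^{\varepsilon/2}\sqrt{1+\mathbf{z}_n'(\mathbf{Z}_{n-1}'\mathbf{Z}_{n-1})^{-1}\mathbf{z}_n}\;\hat\sigma_{n-1}\Bigr\}\quad\text{for } n\ge K+3,$$ and $\Gamma_n^\varepsilon:=\mathbb{R}$ for $n<K+3$. Then, under every probability distribution in the Gauss linear model and for each $\varepsilon\in(0,1)$, the events $y_n\notin\Gamma_n^\varepsilon$, $n=K+3,K+4,\dots$, are independent. In particular, the classical predictor is a confidence predictor (at each step, $\Gamma_n^\varepsilon$ is a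 measurable function of $(\mathbf{x}_1,y_1,\dots,\mathbf{x}_{n-1},y_{n-1},\mathbf{x}_n)$, in the sense that $\{y_n\in\Gamma_n^\varepsilon\}$ is a measurable condition on the first $n$ observations, and $\Gamma_n^{\varepsilon_1}\subseteq\Gamma_n^{\varepsilon_2}$ whenever $\varepsilon_1>\varepsilon_2$) that is strongly valid for $n\ge K+3$: in addition to this independence, the probability of $y_n\notin\Gamma_n^\varepsilon$ is exactly $\varepsilon$ for every $n\ge K+3$ and every $\varepsilon\in(0,1)$. -/

import Mathlib

open MeasureTheory ProbabilityTheory Set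
open scoped Matrix ENNReal NNReal

/-! ### The on-line prediction protocol -/

/-- An observation `(x, y)`: a vector of `K` explanatory variables and a real response. -/
abbrev Observation (K : ℕ) : Type := (Fin K → ℝ) × ℝ

/-- A prediction strategy.  `Γ m ε past x` is the prediction region at significance level `ε`
output at step `n = m + 1`, after the `m` observations `past` and the new explanatory
vector `x` have been seen. -/
abbrev PredictionStrategy (K : ℕ) : Type :=
  (m : ℕ) → ℝ → (Fin m → Observation K) → (Fin K → ℝ) → Set ℝ

/-- A confidence predictor: a measurable prediction strategy with nested prediction regions. -/
structure IsConfidencePredictor {K : ℕ} (Γ : PredictionStrategy K) : Prop where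
  measurable : ∀ (m : ℕ), ∀ ε ∈ Ioo (0 : ℝ) 1,
    MeasurableSet {p : (Fin m → Observation K) × (Fin K → ℝ) × ℝ | p.2.2 ∈ Γ m ε p.1 p.2.1}
  nested : ∀ (m : ℕ) (past : Fin m → Observation K) (x : Fin K → ℝ),
    ∀ ε₁ ∈ Ioo (0 : ℝ) 1, ∀ ε₂ ∈ Ioo (0 : ℝ) 1, ε₂ < ε₁ → Γ m ε₁ past x ⊆ Γ m ε₂ past x

/-- The event that an error is made at step `n ≥ 1`: the response `yₙ` is outside the prediction
region.  A point `ζ` of `ℕ → Observation K` is a sequence of observations; the observation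
number `n = 1, 2, …` is `ζ (n - 1)`. -/
def errorEvent {K : ℕ} (Γ : PredictionStrategy K) (ε : ℝ) (n : ℕ+) :
    Set (ℕ → Observation K) :=
  {ζ | (ζ n.natPred).2 ∉ Γ n.natPred ε (fun i : Fin n.natPred => ζ i) (ζ n.natPred).1}

/-- Weak validity for `n ∈ N` in a statistical model (a set of laws of the observation
sequence): the probability of error at step `n` is `ε`. -/
def IsWeaklyValidFor {K : ℕ} (Γ : PredictionStrategy K)
    (model : Set (Measure (ℕ → Observation K))) (N : Set ℕ+) : Prop :=
  ∀ P ∈ model, ∀ n ∈ N, ∀ ε ∈ Ioo (0 : ℝ) 1, P (errorEvent Γ ε n) = ENNReal.ofReal ε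

/-- Strong validity for `n ∈ N` in a statistical model: weak validity, and the errors at the steps
`n ∈ N` are independent for each fixed significance level. -/
def IsStronglyValidFor {K : ℕ} (Γ : PredictionStrategy K)
    (model : Set (Measure (ℕ → Observation K))) (N : Set ℕ+) : Prop :=
  IsWeaklyValidFor Γ model N ∧
    ∀ P ∈ model, ∀ ε ∈ Ioo (0 : ℝ) 1, iIndepSet (fun n : N => errorEvent Γ ε n) P

/-! ### The Gauss linear model -/

/-- The extended explanatory vector `z = (1, x)`. -/
def extendedVec {K : ℕ} (x : Fin K → ℝ) : Fin (K + 1) → ℝ := Fin.cons 1 x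

/-- The matrix `Z` whose rows are the extended explanatory vectors. -/
def designMatrix {K l : ℕ} (x : Fin l → Fin K → ℝ) : Matrix (Fin l) (Fin (K + 1)) ℝ :=
  Matrix.of fun i => extendedVec (x i)

/-- For every `l`, the design matrix of the first `l` explanatory vectors has full rank. -/
def HasFullRank {K : ℕ} (x : ℕ → Fin K → ℝ) : Prop :=
  ∀ l : ℕ, (designMatrix fun i : Fin l => x i).rank = min l (K + 1)

/-- The sequence of observations `(xₙ, yₙ)` with `yₙ = α + β · xₙ + ξₙ`. -/
def linearObservations {K : ℕ} (α : ℝ) (β : Fin K → ℝ)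
    (p : (ℕ → Fin K → ℝ) × (ℕ → ℝ)) : ℕ → Observation K :=
  fun n => (p.1 n, α + β ⬝ᵥ p.1 n + p.2 n)

/-- The Gauss linear model: the laws of the sequences `(xₙ, yₙ)`, `yₙ = α + β · xₙ + ξₙ`, where
`α`, `β`, `σ² > 0` are arbitrary, the `ξₙ` are IID `N(0, σ²)`, and the sequence of explanatory
vectors has an arbitrary law `ν`, is independent of the noise and has design matrices of full rank.
Deterministic explanatory vectors are the case where `ν` is a Dirac measure. -/
def gaussLinearModel (K : ℕ) : Set (Measure (ℕ → Observation K)) :=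
  {P | ∃ (α : ℝ) (β : Fin K → ℝ) (σsq : ℝ≥0) (ν : Measure (ℕ → Fin K → ℝ)),
    0 < σsq ∧ IsProbabilityMeasure ν ∧ (∀ᵐ x ∂ν, HasFullRank x) ∧
    P = (ν.prod (Measure.infinitePi fun _ : ℕ => gaussianReal 0 σsq)).map
      (linearObservations α β)}

/-! ### Student's t-distribution -/

/-- The t-distribution with `m ≥ 1` degrees of freedom: the law of `X / √(V / m)`, where `X` is
standard normal and `V`, independent of `X`, is the sum of the squares of `m` independent standard
normal variables (a chi-squared variable with `m` degrees of freedom). -/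
noncomputable def studentT (m : ℕ) : Measure ℝ :=
  ((gaussianReal 0 1).prod (Measure.pi fun _ : Fin m => gaussianReal 0 1)).map
    fun p => p.1 / √((∑ i, p.2 i ^ 2) / m)

/-- The upper `δ` point of a law `μ` on the line: the (least) `t` whose upper tail `μ (t, ∞)`
is at most `δ` (equal to `δ` if `μ` has no atoms). -/
noncomputable def upperPoint (μ : Measure ℝ) (δ : ℝ) : ℝ :=
  sInf {t : ℝ | μ (Ioi t) ≤ ENNReal.ofReal δ}

/-! ### Least squares and the classical prediction intervals -/

/-- The least-squares estimate `(Z'Z)⁻¹ Z'y` of the parameter vector `(α, β)`. -/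
noncomputable def leastSquares {K l : ℕ} (x : Fin l → Fin K → ℝ) (y : Fin l → ℝ) :
    Fin (K + 1) → ℝ :=
  ((designMatrix x)ᵀ * designMatrix x)⁻¹ *ᵥ ((designMatrix x)ᵀ *ᵥ y)

/-- The estimate `(y - Zγ)'(y - Zγ) / (l - K - 1)` of the noise variance, where `γ` is the
least-squares estimate from the `l` observations. -/
noncomputable def varianceEstimate {K l : ℕ} (x : Fin l → Fin K → ℝ) (y : Fin l → ℝ) : ℝ :=
  (1 / ((l : ℝ) - K - 1)) *
    ((y - designMatrix x *ᵥ leastSquares x y) ⬝ᵥ (y - designMatrix x *ᵥ leastSquares x y))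

/-- The classical prediction interval with centre `leastSquares x y ⬝ᵥ z`, from `l` past
observations and the new explanatory vector `xnew`, with `z = (1, xnew)`.  Here `l = n - 1`, so
that the number of degrees of freedom is `n - K - 2 = l - K - 1`. -/
noncomputable def classicalInterval {K l : ℕ} (ε : ℝ) (x : Fin l → Fin K → ℝ) (y : Fin l → ℝ)
    (xnew : Fin K → ℝ) : Set ℝ :=
  {w : ℝ | |w - leastSquares x y ⬝ᵥ extendedVec xnew| <
    upperPoint (studentT (l - K - 1)) (ε / 2) *
      √(1 + extendedVec xnew ⬝ᵥ
        (((designMatrix x)ᵀ * designMatrix x)⁻¹ *ᵥ extendedVec xnew)) *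
      √(varianceEstimate x y)}

/-- The classical predictor in the Gauss linear model: the classical prediction interval at the
steps `n = m + 1 ≥ K + 3`, and the whole real line at the earlier steps. -/
noncomputable def classicalPredictor (K : ℕ) : PredictionStrategy K :=
  fun m ε past xnew =>
    if K + 3 ≤ m + 1 then
      classicalInterval ε (fun i => (past i).1) (fun i => (past i).2) xnew
    else univ

/-! Condition on the explanatory vectors, so that they are fixed with full rank. The normalized
one-step prediction errors of least squares, `recursiveResidual`, are linear in the responses. Their
coefficient vectors are orthonormal and orthogonal to the columns of the design matrix. They are
therefore free of `α` and `β`, and after division by `σ` they are IID standard normal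
(`HasFullRank.map_recursiveResidual`).

Each new observation adds the square of its recursive residual to the residual sum of squares, which
is zero after `K + 1` observations (`HasFullRank.residualSumSq_eq_sum`). Hence an error at step `n =
K + 2 + m` says exactly that the residual `v m` is large compared with the root mean square of `v 0,
…, v (m - 1)`: this is `studentizedExceedance`, with `m` degrees of freedom.

Such events are independent for IID normal `v`. The events with index below `m` are invariant under
scaling, so they depend only on the direction of `(v 0, …, v (m - 1))`, while event `m` depends only
on its length and on `v m`. Direction and length of a standard Gaussian vector are independent
(`pi_gaussianReal_cone_inter`), because its density is a function of the length. Induction on the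
largest index gives probability `ε ^ k` for any `k` errors. This value does not depend on the
explanatory vectors, so it survives integration over their law, and it yields both validity and
independence. -/

/-! ### Direction and length of a standard Gaussian vector. -/

theorem pi_gaussianReal_eq_withDensity (m : ℕ) :
    Measure.pi (fun _ : Fin m => gaussianReal 0 1) =
      (volume : Measure (Fin m → ℝ)).withDensity fun x =>
        ENNReal.ofReal ((√(2 * Real.pi))⁻¹ ^ m * Real.exp (-(∑ i, x i ^ 2) / 2)) := by
  have hd : ∀ x : Fin m → ℝ, (√(2 * Real.pi))⁻¹ ^ m * Real.exp (-(∑ i, x i ^ 2) / 2) =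
      ∏ i, gaussianPDFReal 0 1 (x i) := by
    intro x
    simp only [gaussianPDFReal, Finset.prod_mul_distrib, NNReal.coe_one, mul_one, sub_zero]
    rw [← Real.exp_sum, ← Finset.sum_div, Finset.sum_neg_distrib]
    simp
  simp_rw [hd]
  refine Measure.pi_eq fun s hs => ?_
  rw [withDensity_apply _ (.univ_pi hs), volume_pi, Measure.restrict_pi_pi,
    ← ofReal_integral_eq_lintegral_ofReal]
  · rw [integral_fintype_prod_eq_prod, ENNReal.ofReal_prod_of_nonneg]
    · refine Finset.prod_congr rfl fun i _ => ?_
      rw [gaussianReal_apply_eq_integral _ one_ne_zero]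
    · exact fun i _ => integral_nonneg fun x => gaussianPDFReal_nonneg _ _ _
  · exact Integrable.fintype_prod fun i => (integrable_gaussianPDFReal 0 1).restrict
  · exact Filter.Eventually.of_forall fun x =>
      Finset.prod_nonneg fun i _ => gaussianPDFReal_nonneg _ _ _

-- A cone is invariant under dilation by `√s`, which carries the unit ball to the ball of radius
-- `√s` and multiplies volume by `√s ^ m`.
open scoped Pointwise in
theorem volume_cone_inter_sum_sq_lt {m : ℕ} {A : Set (Fin m → ℝ)}
    (hA : ∀ c : ℝ, 0 < c → ∀ x ∈ A, c • x ∈ A) {s : ℝ} (hs : 0 < s) :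
    volume (A ∩ {x | ∑ i, x i ^ 2 < s}) =
      ENNReal.ofReal (√s ^ m) * volume (A ∩ {x | ∑ i, x i ^ 2 < 1}) := by
  have hr : 0 < √s := Real.sqrt_pos.2 hs
  have : A ∩ {x | ∑ i, x i ^ 2 < s} = √s • (A ∩ {x | ∑ i, x i ^ 2 < 1}) := by
    ext x
    rw [mem_smul_set_iff_inv_smul_mem₀ hr.ne']
    simp only [mem_inter_iff, mem_ofPred_eq, Pi.smul_apply, smul_eq_mul, mul_pow, inv_pow,
      Real.sq_sqrt hs.le]
    rw [← Finset.mul_sum, inv_mul_lt_iff₀ hs, mul_one]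
    refine and_congr_left fun _ => ⟨hA _ (inv_pos.2 hr) _, fun h => ?_⟩
    simpa [smul_smul, hr.ne'] using hA _ hr _ h
  rw [this, Measure.addHaar_smul_of_nonneg _ hr.le]
  simp

theorem volume_sum_sq_lt_ne_top (m : ℕ) (s : ℝ) :
    volume {x : Fin m → ℝ | ∑ i, x i ^ 2 < s} ≠ ∞ := by
  refine ((measure_mono fun x hx => ?_).trans_lt
    (measure_closedBall_lt_top (x := (0 : Fin m → ℝ)) (r := √s))).ne
  rw [mem_closedBall_zero_iff, pi_norm_le_iff_of_nonneg (Real.sqrt_nonneg _)]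
  intro i
  refine Real.abs_le_sqrt (le_trans ?_ (le_of_lt hx))
  exact Finset.single_le_sum (f := fun i => x i ^ 2) (fun j _ => sq_nonneg _) (Finset.mem_univ i)

theorem measurable_sum_sq (m : ℕ) : Measurable fun x : Fin m → ℝ => ∑ i, x i ^ 2 := by fun_prop

/-- The radial parts of Lebesgue measure and of its restriction to a cone are proportional. -/
theorem volume_smul_map_restrict_cone {m : ℕ} {A : Set (Fin m → ℝ)}
    (hA : ∀ c : ℝ, 0 < c → ∀ x ∈ A, c • x ∈ A) :
    volume {x : Fin m → ℝ | ∑ i, x i ^ 2 < 1} •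
        (volume.restrict A).map (fun x => ∑ i, x i ^ 2) =
      volume (A ∩ {x : Fin m → ℝ | ∑ i, x i ^ 2 < 1}) •
        volume.map (fun x : Fin m → ℝ => ∑ i, x i ^ 2) := by
  have hS := measurable_sum_sq m
  have hpre : ∀ s : ℝ, (fun x : Fin m → ℝ => ∑ i, x i ^ 2) ⁻¹' Iio s =
    {x | ∑ i, x i ^ 2 < s} := fun s => rfl
  refine Measure.ext_of_generateFrom_of_iUnion (range Iio) (fun n : ℕ => Iio (n : ℝ))
    (borel_eq_generateFrom_Iio ℝ ▸ BorelSpace.measurable_eq) isPiSystem_Iio ?_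
    (fun n => ⟨_, rfl⟩) (fun n => ?_) ?_
  · exact eq_univ_of_forall fun x => mem_iUnion.2 (exists_nat_gt x)
  · rw [Measure.smul_apply, Measure.map_apply hS measurableSet_Iio, smul_eq_mul, hpre]
    refine ENNReal.mul_ne_top (volume_sum_sq_lt_ne_top m 1) (ne_top_of_le_ne_top
      (volume_sum_sq_lt_ne_top m n) (Measure.restrict_apply_le _ _))
  · rintro _ ⟨s, rfl⟩
    rw [Measure.smul_apply, Measure.smul_apply, Measure.map_apply hS measurableSet_Iio,
      Measure.map_apply hS measurableSet_Iio, hpre,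
      Measure.restrict_apply (hpre s ▸ hS measurableSet_Iio), smul_eq_mul, smul_eq_mul]
    -- For `s ≤ 0` both balls are empty; for `s > 0` the cone and the whole space acquire the same
    -- factor `√s ^ m`, so cross-multiplying by the unit-ball volumes gives equality.
    rcases le_or_gt s 0 with hs | hs
    · have : {x : Fin m → ℝ | ∑ i, x i ^ 2 < s} = ∅ :=
        eq_empty_of_forall_notMem fun x hx =>
          absurd (lt_of_lt_of_le hx hs) (not_lt.2 (Finset.sum_nonneg fun i _ => sq_nonneg _))
      simp [this]
    · rw [inter_comm, volume_cone_inter_sum_sq_lt hA hs]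
      have := volume_cone_inter_sum_sq_lt (m := m) (A := univ) (fun _ _ _ _ => mem_univ _) hs
      rw [univ_inter, univ_inter] at this
      rw [this]
      ring

/-- The direction and the length of a standard Gaussian vector are independent. -/
theorem pi_gaussianReal_cone_inter {m : ℕ} {A : Set (Fin m → ℝ)} (hAm : MeasurableSet A)
    (hA : ∀ c : ℝ, 0 < c → ∀ x ∈ A, c • x ∈ A) {B : Set ℝ} (hB : MeasurableSet B) :
    Measure.pi (fun _ : Fin m => gaussianReal 0 1) (A ∩ {x | ∑ i, x i ^ 2 ∈ B}) =
      Measure.pi (fun _ : Fin m => gaussianReal 0 1) A *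
        Measure.pi (fun _ : Fin m => gaussianReal 0 1) {x | ∑ i, x i ^ 2 ∈ B} := by
  set d := volume {x : Fin m → ℝ | ∑ i, x i ^ 2 < 1} with hd
  set c := volume (A ∩ {x : Fin m → ℝ | ∑ i, x i ^ 2 < 1}) with hc
  set γ := Measure.pi (fun _ : Fin m => gaussianReal 0 1) with hγ
  have hS := measurable_sum_sq m
  have hd0 : d ≠ 0 := by
    have ho : IsOpen {x : Fin m → ℝ | ∑ i, x i ^ 2 < 1} :=
      isOpen_lt (by fun_prop) continuous_const
    exact (ho.measure_pos volume ⟨0, by simp⟩).ne'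
  have hdt : d ≠ ∞ := volume_sum_sq_lt_ne_top m 1
  set f : ℝ → ℝ≥0∞ := fun r =>
    ENNReal.ofReal ((√(2 * Real.pi))⁻¹ ^ m * Real.exp (-r / 2)) with hf
  have hfm : Measurable f := by fun_prop
  -- The Gaussian density is `f` of the squared length, so integrating `f` over `B` carries the
  -- proportionality of radial parts from Lebesgue to Gaussian measure.
  have key : ∀ B : Set ℝ, MeasurableSet B →
      d * γ (A ∩ {x | ∑ i, x i ^ 2 ∈ B}) = c * γ {x | ∑ i, x i ^ 2 ∈ B} := by
    intro B hB
    have hBS : MeasurableSet {x : Fin m → ℝ | ∑ i, x i ^ 2 ∈ B} := hS hB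
    have h := congrArg (fun μ : Measure ℝ => ∫⁻ r in B, f r ∂μ)
      (volume_smul_map_restrict_cone hA)
    simp only [Measure.restrict_smul, lintegral_smul_measure, smul_eq_mul] at h
    rw [setLIntegral_map hB hfm hS, setLIntegral_map hB hfm hS,
      Measure.restrict_restrict (hS hB), inter_comm] at h
    rw [hγ, pi_gaussianReal_eq_withDensity, withDensity_apply _ (hAm.inter hBS),
      withDensity_apply _ hBS]
    exact h
  -- Taking `B = univ` identifies the constant of proportionality: `c = d * γ A`.
  have h1 := key univ .univ
  have h2 := key B hB
  simp only [mem_univ, ofPred_true, inter_univ] at h1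
  rw [show γ univ = 1 from measure_univ, mul_one] at h1
  rw [← h1, mul_assoc] at h2
  exact (ENNReal.mul_right_inj hd0 hdt).1 h2

/-! ### Upper points of laws on the line. -/

theorem continuous_cdf (μ : Measure ℝ) [IsProbabilityMeasure μ] [NullSingletonClass μ] :
    Continuous (cdf μ) := by
  refine continuous_iff_continuousAt.2 fun a => ?_
  rw [(cdf μ).mono.continuousAt_iff_leftLim_eq_rightLim, StieltjesFunction.rightLim_eq]
  refine le_antisymm ((cdf μ).mono.leftLim_le le_rfl) ?_
  have h := (cdf μ).measure_singleton a
  rw [measure_cdf, measure_singleton] at h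
  linarith [ENNReal.ofReal_eq_zero.1 h.symm]

theorem measure_Ioi_eq_ofReal_cdf (μ : Measure ℝ) [IsProbabilityMeasure μ] (t : ℝ) :
    μ (Ioi t) = ENNReal.ofReal (1 - cdf μ t) := by
  rw [← compl_Iic, prob_compl_eq_one_sub measurableSet_Iic, ← ofReal_cdf,
    ENNReal.ofReal_sub _ (cdf_nonneg μ t), ENNReal.ofReal_one]

theorem measure_Ioi_le_ofReal_iff (μ : Measure ℝ) [IsProbabilityMeasure μ] {δ t : ℝ}
    (hδ : 0 ≤ δ) : μ (Ioi t) ≤ ENNReal.ofReal δ ↔ 1 - δ ≤ cdf μ t := by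
  rw [measure_Ioi_eq_ofReal_cdf, ENNReal.ofReal_le_ofReal_iff hδ]
  constructor <;> intro h <;> linarith

theorem bddBelow_upper_tail_le (μ : Measure ℝ) [IsProbabilityMeasure μ] {δ : ℝ}
    (h0 : 0 < δ) (h1 : δ < 1) : BddBelow {t : ℝ | μ (Ioi t) ≤ ENNReal.ofReal δ} := by
  obtain ⟨b, hb⟩ := ((tendsto_cdf_atBot μ).eventually_lt_const (sub_pos.2 h1)).exists
  refine ⟨b, fun t ht => ?_⟩
  by_contra! hlt
  linarith [(measure_Ioi_le_ofReal_iff μ h0.le).1 ht, monotone_cdf μ hlt.le]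

theorem nonempty_upper_tail_le (μ : Measure ℝ) [IsProbabilityMeasure μ] {δ : ℝ} (h0 : 0 < δ) :
    {t : ℝ | μ (Ioi t) ≤ ENNReal.ofReal δ}.Nonempty := by
  obtain ⟨b, hb⟩ :=
    ((tendsto_cdf_atTop μ).eventually_const_lt (show 1 - δ < 1 by linarith)).exists
  exact ⟨b, (measure_Ioi_le_ofReal_iff μ h0.le).2 hb.le⟩

theorem upperPoint_anti (μ : Measure ℝ) [IsProbabilityMeasure μ] {δ₁ δ₂ : ℝ}
    (h0 : 0 < δ₂) (h : δ₂ ≤ δ₁) (h1 : δ₁ < 1) : upperPoint μ δ₁ ≤ upperPoint μ δ₂ :=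
  csInf_le_csInf (bddBelow_upper_tail_le μ (h0.trans_le h) h1) (nonempty_upper_tail_le μ h0)
    fun _ ht => le_trans ht (ENNReal.ofReal_le_ofReal h)

/-- Continuity of the distribution function is used twice. The set defining the upper point is
closed, so it contains its infimum and the tail is at most `δ`. By the intermediate value theorem
some `t` has tail exactly `δ`, and the upper point does not exceed it. -/
theorem measure_Ioi_upperPoint (μ : Measure ℝ) [IsProbabilityMeasure μ] [NullSingletonClass μ]
    {δ : ℝ} (h0 : 0 < δ) (h1 : δ < 1) : μ (Ioi (upperPoint μ δ)) = ENNReal.ofReal δ := by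
  have hS : {t : ℝ | μ (Ioi t) ≤ ENNReal.ofReal δ} = {t | 1 - δ ≤ cdf μ t} :=
    ext fun t => measure_Ioi_le_ofReal_iff μ h0.le
  have hbdd := bddBelow_upper_tail_le μ h0 h1
  have hmem := (hS ▸ isClosed_le continuous_const (continuous_cdf μ)).csInf_mem
    (nonempty_upper_tail_le μ h0) hbdd
  refine le_antisymm hmem ?_
  obtain ⟨t, ht⟩ : ∃ t, cdf μ t = 1 - δ := by
    obtain ⟨a, ha⟩ := ((tendsto_cdf_atBot μ).eventually_lt_const (sub_pos.2 h1)).exists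
    obtain ⟨b, hb⟩ :=
      ((tendsto_cdf_atTop μ).eventually_const_lt (show 1 - δ < 1 by linarith)).exists
    exact mem_range_of_exists_le_of_exists_ge (continuous_cdf μ) ⟨a, ha.le⟩ ⟨b, hb.le⟩
  have hle : upperPoint μ δ ≤ t :=
    csInf_le hbdd ((measure_Ioi_le_ofReal_iff μ h0.le).2 ht.ge)
  rw [measure_Ioi_eq_ofReal_cdf]
  exact ENNReal.ofReal_le_ofReal (by linarith [monotone_cdf μ hle])

theorem measure_Iio_neg_of_map_neg {μ : Measure ℝ} (hμ : μ.map Neg.neg = μ) (t : ℝ) :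
    μ (Iio (-t)) = μ (Ioi t) := by
  conv_rhs => rw [← hμ]
  rw [Measure.map_apply measurable_neg measurableSet_Ioi]
  congr 1
  ext x
  simp

/-- For a symmetric atomless law, the two-sided tail beyond the upper `ε / 2` point is `ε`. -/
theorem measure_upperPoint_le_abs {μ : Measure ℝ} [IsProbabilityMeasure μ] [NullSingletonClass μ]
    (hμ : μ.map Neg.neg = μ) {ε : ℝ} (h0 : 0 < ε) (h1 : ε < 1) :
    μ {x | upperPoint μ (ε / 2) ≤ |x|} = ENNReal.ofReal ε := by
  set t := upperPoint μ (ε / 2) with ht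
  have htail : μ (Ioi t) = ENNReal.ofReal (ε / 2) :=
    measure_Ioi_upperPoint μ (by linarith) (by linarith)
  have hneg : μ (Iio (-t)) = ENNReal.ofReal (ε / 2) :=
    (measure_Iio_neg_of_map_neg hμ t).trans htail
  -- If `t ≤ 0`, the two tails would cover the line, forcing `1 ≤ ε`. Positivity of `t` then makes
  -- the tails disjoint.
  have htpos : 0 < t := by
    by_contra! hle
    have hcover : (univ : Set ℝ) ⊆ Ioi t ∪ Iic (-t) := fun x _ => by
      rcases lt_or_ge t x with h | h
      · exact Or.inl h
      · exact Or.inr (h.trans (hle.trans (by linarith)))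
    have h := (measure_mono hcover).trans (measure_union_le (μ := μ) _ _)
    rw [measure_univ, measure_congr Iio_ae_eq_Iic.symm, htail, hneg,
      ← ENNReal.ofReal_add (by linarith) (by linarith), add_halves, ENNReal.one_le_ofReal] at h
    linarith
  have hset : {x : ℝ | t ≤ |x|} = Ici t ∪ Iic (-t) := by
    ext x
    simp only [mem_ofPred_eq, mem_union, mem_Ici, mem_Iic, le_abs, le_neg]
  rw [hset, measure_union _ measurableSet_Iic, measure_congr Ioi_ae_eq_Ici.symm,
    measure_congr Iio_ae_eq_Iic.symm, htail, hneg, ← ENNReal.ofReal_add (by linarith) (by linarith),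
    add_halves]
  rw [disjoint_left]
  intro x hx hx'
  simp only [mem_Ici, mem_Iic] at hx hx'
  linarith

/-! ### The t-distribution is symmetric and atomless. -/

theorem measurable_studentT_ratio (m : ℕ) :
    Measurable fun p : ℝ × (Fin m → ℝ) => p.1 / √((∑ i, p.2 i ^ 2) / m) := by fun_prop

instance isProbabilityMeasure_studentT (m : ℕ) : IsProbabilityMeasure (studentT m) :=
  Measure.isProbabilityMeasure_map (measurable_studentT_ratio m).aemeasurable

theorem studentT_map_neg (m : ℕ) : (studentT m).map Neg.neg = studentT m := by
  have hγ : (gaussianReal 0 1).map (fun x : ℝ => -x) = gaussianReal 0 1 := by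
    rw [gaussianReal_map_neg, neg_zero]
  rw [studentT, Measure.map_map measurable_neg (measurable_studentT_ratio m)]
  have hprod : ((gaussianReal 0 1).prod (Measure.pi fun _ : Fin m => gaussianReal 0 1)).map
      (Prod.map (fun x : ℝ => -x) id) =
        (gaussianReal 0 1).prod (Measure.pi fun _ : Fin m => gaussianReal 0 1) := by
    rw [← Measure.map_prod_map _ _ measurable_neg measurable_id, hγ, Measure.map_id]
  conv_rhs => rw [← hprod, Measure.map_map (measurable_studentT_ratio m) (by fun_prop)]
  congr 1
  ext p
  simp [neg_div]

/-- One coordinate is already nonzero almost surely. This excludes the zero denominator in the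
t-ratio, where division takes its default value. -/
theorem sum_sq_pos_ae {m : ℕ} (hm : 0 < m) :
    ∀ᵐ x ∂(Measure.pi fun _ : Fin m => gaussianReal 0 1), 0 < ∑ i, x i ^ 2 := by
  have := nullSingletonClass_gaussianReal (μ := 0) (v := 1) one_ne_zero
  have h := Measure.pi_hyperplane (fun _ : Fin m => gaussianReal 0 1) ⟨0, hm⟩ 0
  filter_upwards [measure_eq_zero_iff_ae_notMem.1 h] with x hx
  exact Finset.sum_pos' (fun i _ => sq_nonneg _) ⟨⟨0, hm⟩, Finset.mem_univ _, by positivity⟩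

theorem sum_sq_pos_ae_prod {m : ℕ} (hm : 0 < m) :
    ∀ᵐ p ∂((gaussianReal 0 1).prod (Measure.pi fun _ : Fin m => gaussianReal 0 1)),
      0 < ∑ i, p.2 i ^ 2 :=
  Measure.quasiMeasurePreserving_snd.ae (sum_sq_pos_ae hm)

/-- Once the denominator is fixed, the event pins the normal numerator to a single value; Fubini
concludes. -/
theorem nullSingletonClass_studentT {m : ℕ} (hm : 0 < m) : NullSingletonClass (studentT m) := by
  refine ⟨fun c => ?_⟩
  have := nullSingletonClass_gaussianReal (μ := 0) (v := 1) one_ne_zero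
  rw [studentT, Measure.map_apply (measurable_studentT_ratio m) (measurableSet_singleton c)]
  have hs : MeasurableSet {p : ℝ × (Fin m → ℝ) | p.1 = c * √((∑ i, p.2 i ^ 2) / m)} :=
    measurableSet_eq_fun (by fun_prop) (by fun_prop)
  have h0 : ((gaussianReal 0 1).prod (Measure.pi fun _ : Fin m => gaussianReal 0 1))
      {p : ℝ × (Fin m → ℝ) | p.1 = c * √((∑ i, p.2 i ^ 2) / m)} = 0 := by
    rw [Measure.prod_apply_symm hs]
    simp
  refine measure_mono_null_ae ?_ h0
  filter_upwards [sum_sq_pos_ae_prod hm] with p hp h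
  have hq : 0 < √((∑ i, p.2 i ^ 2) / m) := by positivity
  exact (div_eq_iff hq.ne').1 h

/-- A studentized standard normal variable exceeds the upper `ε / 2` point of the
t-distribution in absolute value with probability `ε`. -/
theorem prod_upperPoint_mul_le_abs {m : ℕ} (hm : 0 < m) {ε : ℝ} (h0 : 0 < ε) (h1 : ε < 1) :
    ((gaussianReal 0 1).prod (Measure.pi fun _ : Fin m => gaussianReal 0 1))
      {p | upperPoint (studentT m) (ε / 2) * √((∑ i, p.2 i ^ 2) / m) ≤ |p.1|} =
        ENNReal.ofReal ε := by
  have := nullSingletonClass_studentT hm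
  rw [← measure_upperPoint_le_abs (studentT_map_neg m) h0 h1]
  conv_rhs => rw [studentT]
  rw [Measure.map_apply (measurable_studentT_ratio m)
    (measurableSet_le measurable_const (by fun_prop))]
  refine measure_congr ?_
  filter_upwards [sum_sq_pos_ae_prod hm] with p hp
  have hq : 0 < √((∑ i, p.2 i ^ 2) / m) := by positivity
  refine propext ?_
  change _ ≤ _ ↔ _ ≤ |p.1 / _|
  rw [abs_div, abs_of_pos hq, le_div_iff₀ hq]
  rfl

/-! ### Studentized exceedances in an IID normal sequence. -/

/-- An event on the direction of a standard Gaussian vector is independent of an event that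
depends on its length and on an independent variable. -/
theorem pi_prod_cone_inter {m : ℕ} {A : Set (Fin m → ℝ)} (hAm : MeasurableSet A)
    (hA : ∀ c : ℝ, 0 < c → ∀ x ∈ A, c • x ∈ A) {C : Set (ℝ × ℝ)} (hC : MeasurableSet C) :
    ((gaussianReal 0 1).prod (Measure.pi fun _ : Fin m => gaussianReal 0 1))
      {p | p.2 ∈ A ∧ (p.1, ∑ i, p.2 i ^ 2) ∈ C} =
    Measure.pi (fun _ : Fin m => gaussianReal 0 1) A *
      ((gaussianReal 0 1).prod (Measure.pi fun _ : Fin m => gaussianReal 0 1))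
        {p | (p.1, ∑ i, p.2 i ^ 2) ∈ C} := by
  have hCm : MeasurableSet {p : ℝ × (Fin m → ℝ) | (p.1, ∑ i, p.2 i ^ 2) ∈ C} :=
    (show Measurable fun p : ℝ × (Fin m → ℝ) => (p.1, ∑ i, p.2 i ^ 2) by fun_prop) hC
  have hACm : MeasurableSet {p : ℝ × (Fin m → ℝ) | p.2 ∈ A ∧ (p.1, ∑ i, p.2 i ^ 2) ∈ C} :=
    (measurable_snd hAm).inter hCm
  rw [Measure.prod_apply hACm, Measure.prod_apply hCm,
    ← lintegral_const_mul _ (measurable_measure_prodMk_left hCm)]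
  -- With the independent variable frozen at `v`, the second event concerns the length only.
  refine lintegral_congr fun v => ?_
  exact pi_gaussianReal_cone_inter hAm hA (B := {r | (v, r) ∈ C}) (measurable_prodMk_left hC)

/-- The event that `v m` is large in comparison with its predecessors. -/
def studentizedExceedance (ε : ℝ) (m : ℕ) : Set (ℕ → ℝ) :=
  {v | upperPoint (studentT m) (ε / 2) * √((∑ j ∈ Finset.range m, v j ^ 2) / m) ≤ |v m|}

theorem measurableSet_studentizedExceedance (ε : ℝ) (m : ℕ) :
    MeasurableSet (studentizedExceedance ε m) :=
  measurableSet_le (by fun_prop) (by fun_prop)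

theorem studentizedExceedance_congr {ε : ℝ} {m : ℕ} {v w : ℕ → ℝ} (h : ∀ j ≤ m, v j = w j) :
    v ∈ studentizedExceedance ε m ↔ w ∈ studentizedExceedance ε m := by
  simp only [studentizedExceedance, mem_ofPred_eq, h m le_rfl]
  rw [Finset.sum_congr rfl fun j hj => by rw [h j (Finset.mem_range.1 hj).le]]

/-- Both sides of the inequality are homogeneous of degree one. This makes the earlier events cones
in the induction, and later removes the unknown `σ`. -/
theorem smul_mem_studentizedExceedance {ε : ℝ} {m : ℕ} {v : ℕ → ℝ} {c : ℝ} (hc : 0 < c) :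
    c • v ∈ studentizedExceedance ε m ↔ v ∈ studentizedExceedance ε m := by
  simp only [studentizedExceedance, mem_ofPred_eq, Pi.smul_apply, smul_eq_mul, mul_pow, abs_mul,
    abs_of_pos hc]
  rw [← Finset.mul_sum, mul_div_assoc, Real.sqrt_mul (sq_nonneg c), Real.sqrt_sq hc.le,
    mul_left_comm, mul_le_mul_iff_right₀ hc]

theorem infinitePi_map_eval_prefix (m : ℕ) :
    (Measure.infinitePi fun _ : ℕ => gaussianReal 0 1).map
        (fun v => (v m, fun i : Fin m => v i)) =
      (gaussianReal 0 1).prod (Measure.pi fun _ : Fin m => gaussianReal 0 1) := by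
  set μ := Measure.infinitePi fun _ : ℕ => gaussianReal 0 1
  have hind : iIndepFun (fun (i : ℕ) (v : ℕ → ℝ) => v i) μ :=
    iIndepFun_infinitePi (P := fun _ : ℕ => gaussianReal 0 1) (X := fun _ x => x)
      fun _ => measurable_id
  have hev : ∀ i : ℕ, μ.map (fun v : ℕ → ℝ => v i) = gaussianReal 0 1 := fun i =>
    Measure.infinitePi_map_eval (fun _ : ℕ => gaussianReal 0 1) i
  have hpi : μ.map (fun (v : ℕ → ℝ) (i : Fin m) => v i) =
      Measure.pi fun _ : Fin m => gaussianReal 0 1 := by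
    have h := (hind.precomp Fin.val_injective (g := fun i : Fin m => (i : ℕ))).map_fun_eq_pi_map
      fun i => (measurable_pi_apply _).aemeasurable
    simpa only [hev] using h
  have hpair : IndepFun (fun v : ℕ → ℝ => v m) (fun v (i : Fin m) => v i) μ := by
    have h := hind.indepFun_finset {m} (Finset.range m) (by simp) fun i => measurable_pi_apply i
    exact h.comp (φ := fun u : ({m} : Finset ℕ) → ℝ => u ⟨m, by simp⟩)
      (ψ := fun (u : Finset.range m → ℝ) (i : Fin m) => u ⟨i, by simp⟩)
      (by fun_prop) (by fun_prop)
  rw [(indepFun_iff_map_prod_eq_prod_map_map (measurable_pi_apply m).aemeasurable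
    (measurable_pi_lambda _ fun i => measurable_pi_apply _).aemeasurable).1 hpair, hev, hpi]

/-- The studentized exceedances of an IID normal sequence are independent of probability `ε`. -/
theorem infinitePi_biInter_studentizedExceedance {ε : ℝ} (h0 : 0 < ε) (h1 : ε < 1)
    (s : Finset ℕ) (hs : ∀ m ∈ s, 0 < m) :
    Measure.infinitePi (fun _ : ℕ => gaussianReal 0 1) (⋂ m ∈ s, studentizedExceedance ε m) =
      ENNReal.ofReal ε ^ s.card := by
  induction s using Finset.induction_on_max with
  | empty => simp
  | insert m s hlt ih =>
    have ih := ih fun k hk => hs k (Finset.mem_insert_of_mem hk)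
    have hm : 0 < m := hs m (Finset.mem_insert_self m s)
    have hms : m ∉ s := fun h => lt_irrefl m (hlt m h)
    -- Padding by zeros lets the events with index below `m` be read as a subset of `Fin m → ℝ`;
    -- they do not see the padded coordinates.
    set extend : (Fin m → ℝ) → ℕ → ℝ := fun x j => if h : j < m then x ⟨j, h⟩ else 0 with hext
    have hextm : Measurable extend := by
      refine measurable_pi_lambda _ fun j => ?_
      by_cases h : j < m
      · simpa only [hext, h, dif_pos] using measurable_pi_apply _
      · simpa only [hext, h, dif_neg, not_false_iff] using measurable_const
    set A : Set (Fin m → ℝ) := extend ⁻¹' (⋂ k ∈ s, studentizedExceedance ε k) with hA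
    have hInterm : MeasurableSet (⋂ k ∈ s, studentizedExceedance ε k) :=
      s.measurableSet_biInter fun k _ => measurableSet_studentizedExceedance ε k
    have hAm : MeasurableSet A := hextm hInterm
    have hAcone : ∀ c : ℝ, 0 < c → ∀ x ∈ A, c • x ∈ A := by
      intro c hc x hx
      have : extend (c • x) = c • extend x := by
        ext j
        by_cases h : j < m <;> simp [hext, h]
      simp only [hA, mem_preimage, mem_iInter, this] at hx ⊢
      exact fun k hk => (smul_mem_studentizedExceedance hc).2 (hx k hk)
    have hAmem : ∀ v : ℕ → ℝ, (fun i : Fin m => v i) ∈ A ↔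
        v ∈ ⋂ k ∈ s, studentizedExceedance ε k := by
      intro v
      simp only [hA, mem_preimage, mem_iInter]
      refine forall₂_congr fun k hk => studentizedExceedance_congr fun j hj => ?_
      simp [hext, hj.trans_lt (hlt k hk)]
    set C : Set (ℝ × ℝ) :=
      {q | upperPoint (studentT m) (ε / 2) * √(q.2 / m) ≤ |q.1|} with hC
    have hCm : MeasurableSet C := measurableSet_le (by fun_prop) (by fun_prop)
    have hmap : Measurable fun v : ℕ → ℝ => (v m, fun i : Fin m => v i) := by fun_prop
    have hset : (⋂ k ∈ insert m s, studentizedExceedance ε k) =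
        (fun v : ℕ → ℝ => (v m, fun i : Fin m => v i)) ⁻¹'
          {p | p.2 ∈ A ∧ (p.1, ∑ i, p.2 i ^ 2) ∈ C} := by
      ext v
      rw [Finset.set_biInter_insert, mem_inter_iff, and_comm, ← hAmem]
      simp only [studentizedExceedance, mem_preimage, mem_ofPred_eq, hC, Finset.sum_range]
    have hACm : MeasurableSet {p : ℝ × (Fin m → ℝ) | p.2 ∈ A ∧ (p.1, ∑ i, p.2 i ^ 2) ∈ C} :=
      (measurable_snd hAm).inter
        ((show Measurable fun p : ℝ × (Fin m → ℝ) => (p.1, ∑ i, p.2 i ^ 2) by fun_prop) hCm)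
    have hfst : (Measure.pi fun _ : Fin m => gaussianReal 0 1) A = ENNReal.ofReal ε ^ s.card := by
      rw [← ih, ← one_mul ((Measure.pi fun _ : Fin m => gaussianReal 0 1) A),
        ← measure_univ (μ := gaussianReal 0 1), ← Measure.prod_prod,
        ← infinitePi_map_eval_prefix, Measure.map_apply hmap (.prod .univ hAm)]
      congr 1
      ext v
      simp [hAmem]
    rw [hset, ← Measure.map_apply hmap hACm, infinitePi_map_eval_prefix,
      pi_prod_cone_inter hAm hAcone hCm, hfst, Finset.card_insert_of_notMem hms, pow_succ]
    congr 1
    exact prod_upperPoint_mul_le_abs hm h0 h1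

/-! ### Recursive least squares and recursive residuals. -/

section LeastSquares

variable {K : ℕ} (x : ℕ → Fin K → ℝ)

/-- The Gram matrix `Z'Z` of the first `l` extended explanatory vectors. -/
def gramMatrix (l : ℕ) : Matrix (Fin (K + 1)) (Fin (K + 1)) ℝ :=
  (designMatrix fun i : Fin l => x i)ᵀ * designMatrix fun i : Fin l => x i

/-- The least-squares estimate from the first `l` observations. -/
noncomputable def leastSquaresPrefix (l : ℕ) (y : ℕ → ℝ) : Fin (K + 1) → ℝ :=
  leastSquares (fun i : Fin l => x i) fun i : Fin l => y i

/-- The variance of the error of the least-squares prediction of the observation `l`, in units of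
the noise variance. -/
noncomputable def predictionVariance (l : ℕ) : ℝ :=
  1 + extendedVec (x l) ⬝ᵥ ((gramMatrix x l)⁻¹ *ᵥ extendedVec (x l))

/-- The normalized error of the least-squares prediction of the observation `l`. -/
noncomputable def recursiveResidual (l : ℕ) (y : ℕ → ℝ) : ℝ :=
  (y l - leastSquaresPrefix x l y ⬝ᵥ extendedVec (x l)) / √(predictionVariance x l)

theorem designMatrix_mulVec (l : ℕ) (v : Fin (K + 1) → ℝ) (i : Fin l) :
    ((designMatrix fun i : Fin l => x i) *ᵥ v) i = extendedVec (x i) ⬝ᵥ v := rfl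

theorem transpose_designMatrix_mulVec (l : ℕ) (y : ℕ → ℝ) :
    (designMatrix fun i : Fin l => x i)ᵀ *ᵥ (fun i : Fin l => y i) =
      ∑ i ∈ Finset.range l, y i • extendedVec (x i) := by
  ext k
  rw [Finset.sum_apply, Finset.sum_range]
  simp [Matrix.mulVec, dotProduct, designMatrix, mul_comm]

theorem gramMatrix_mulVec (l : ℕ) (v : Fin (K + 1) → ℝ) :
    gramMatrix x l *ᵥ v =
      ∑ i ∈ Finset.range l, (extendedVec (x i) ⬝ᵥ v) • extendedVec (x i) := by
  rw [gramMatrix, ← Matrix.mulVec_mulVec]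
  exact transpose_designMatrix_mulVec x l fun i => extendedVec (x i) ⬝ᵥ v

theorem gramMatrix_succ_mulVec (l : ℕ) (v : Fin (K + 1) → ℝ) :
    gramMatrix x (l + 1) *ᵥ v =
      gramMatrix x l *ᵥ v + (extendedVec (x l) ⬝ᵥ v) • extendedVec (x l) := by
  rw [gramMatrix_mulVec, gramMatrix_mulVec, Finset.sum_range_succ]

theorem gramMatrix_mulVec_dotProduct (l : ℕ) (u v : Fin (K + 1) → ℝ) :
    (gramMatrix x l *ᵥ u) ⬝ᵥ v =
      ∑ i ∈ Finset.range l, (extendedVec (x i) ⬝ᵥ u) * (extendedVec (x i) ⬝ᵥ v) := by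
  rw [gramMatrix_mulVec, sum_dotProduct]
  simp

theorem gramMatrix_transpose (l : ℕ) : (gramMatrix x l)ᵀ = gramMatrix x l := by
  simp [gramMatrix, Matrix.transpose_mul]

theorem dotProduct_gramMatrix_inv_mulVec (l : ℕ) (u v : Fin (K + 1) → ℝ) :
    ((gramMatrix x l)⁻¹ *ᵥ u) ⬝ᵥ v = u ⬝ᵥ ((gramMatrix x l)⁻¹ *ᵥ v) := by
  rw [Matrix.dotProduct_mulVec, ← Matrix.mulVec_transpose, Matrix.transpose_nonsing_inv,
    gramMatrix_transpose]

theorem leastSquaresPrefix_eq (l : ℕ) (y : ℕ → ℝ) :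
    leastSquaresPrefix x l y =
      (gramMatrix x l)⁻¹ *ᵥ ∑ i ∈ Finset.range l, y i • extendedVec (x i) := by
  rw [← transpose_designMatrix_mulVec]
  rfl

variable {x}

theorem isUnit_of_rank_eq_card {n : Type*} [Fintype n] [DecidableEq n] {A : Matrix n n ℝ}
    (h : A.rank = Fintype.card n) : IsUnit A := by
  rw [← Matrix.mulVec_surjective_iff_isUnit]
  have : LinearMap.range A.mulVecLin = ⊤ := by
    apply Submodule.eq_top_of_finrank_eq
    rw [Module.finrank_fintype_fun_eq_card, ← h]
    rfl
  exact LinearMap.range_eq_top.1 this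

theorem HasFullRank.isUnit_gramMatrix (hx : HasFullRank x) {l : ℕ} (hl : K + 1 ≤ l) :
    IsUnit (gramMatrix x l).det := by
  rw [← Matrix.isUnit_iff_isUnit_det]
  apply isUnit_of_rank_eq_card
  rw [gramMatrix, Matrix.rank_transpose_mul_self, hx l, min_eq_right hl, Fintype.card_fin]

theorem HasFullRank.gramMatrix_mulVec_inv (hx : HasFullRank x) {l : ℕ} (hl : K + 1 ≤ l)
    (v : Fin (K + 1) → ℝ) : gramMatrix x l *ᵥ ((gramMatrix x l)⁻¹ *ᵥ v) = v := by
  rw [Matrix.mulVec_mulVec, Matrix.mul_nonsing_inv _ (hx.isUnit_gramMatrix hl), Matrix.one_mulVec]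

theorem HasFullRank.gramMatrix_inv_mulVec (hx : HasFullRank x) {l : ℕ} (hl : K + 1 ≤ l)
    (v : Fin (K + 1) → ℝ) : (gramMatrix x l)⁻¹ *ᵥ (gramMatrix x l *ᵥ v) = v := by
  rw [Matrix.mulVec_mulVec, Matrix.nonsing_inv_mul _ (hx.isUnit_gramMatrix hl), Matrix.one_mulVec]

/-- The normal equations. -/
theorem HasFullRank.gramMatrix_mulVec_leastSquaresPrefix (hx : HasFullRank x) {l : ℕ}
    (hl : K + 1 ≤ l) (y : ℕ → ℝ) :
    gramMatrix x l *ᵥ leastSquaresPrefix x l y =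
      ∑ i ∈ Finset.range l, y i • extendedVec (x i) := by
  rw [leastSquaresPrefix_eq, hx.gramMatrix_mulVec_inv hl]

/-- With `G` the Gram matrix and `z` the new extended vector, the sum is the quadratic form of `G`
at `G⁻¹ z`, that is `z ⬝ᵥ G⁻¹ z`. It gives both the positivity of `predictionVariance` and the unit
norm of the residual coefficients. -/
theorem HasFullRank.sum_sq_extendedVec_dotProduct (hx : HasFullRank x) {l : ℕ}
    (hl : K + 1 ≤ l) :
    ∑ i ∈ Finset.range l,
      (extendedVec (x i) ⬝ᵥ ((gramMatrix x l)⁻¹ *ᵥ extendedVec (x l))) ^ 2 =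
        predictionVariance x l - 1 := by
  simp_rw [sq]
  rw [← gramMatrix_mulVec_dotProduct, hx.gramMatrix_mulVec_inv hl, predictionVariance]
  ring

theorem HasFullRank.predictionVariance_pos (hx : HasFullRank x) {l : ℕ} (hl : K + 1 ≤ l) :
    0 < predictionVariance x l := by
  have h := hx.sum_sq_extendedVec_dotProduct hl
  have : 0 ≤ ∑ i ∈ Finset.range l,
      (extendedVec (x i) ⬝ᵥ ((gramMatrix x l)⁻¹ *ᵥ extendedVec (x l))) ^ 2 :=
    Finset.sum_nonneg fun i _ => sq_nonneg _
  linarith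

/-- The right-hand side solves the normal equations for `l + 1` observations, because the Gram
matrix changes by a rank-one term; invertibility makes the solution unique. -/
theorem HasFullRank.leastSquaresPrefix_succ (hx : HasFullRank x) {l : ℕ} (hl : K + 1 ≤ l)
    (y : ℕ → ℝ) :
    leastSquaresPrefix x (l + 1) y = leastSquaresPrefix x l y +
      ((y l - leastSquaresPrefix x l y ⬝ᵥ extendedVec (x l)) / predictionVariance x l) •
        ((gramMatrix x l)⁻¹ *ᵥ extendedVec (x l)) := by
  have hs := (hx.predictionVariance_pos hl).ne'
  rw [← hx.gramMatrix_inv_mulVec (by omega : K + 1 ≤ l + 1) (_ + _), leastSquaresPrefix_eq]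
  congr 1
  rw [gramMatrix_succ_mulVec, Matrix.mulVec_add, hx.gramMatrix_mulVec_leastSquaresPrefix hl,
    Matrix.mulVec_smul, hx.gramMatrix_mulVec_inv hl, Finset.sum_range_succ, add_assoc, ← add_smul]
  congr 2
  rw [dotProduct_add, dotProduct_smul, smul_eq_mul, dotProduct_comm (extendedVec (x l))
    (leastSquaresPrefix x l y)]
  have : extendedVec (x l) ⬝ᵥ ((gramMatrix x l)⁻¹ *ᵥ extendedVec (x l)) =
    predictionVariance x l - 1 := by rw [predictionVariance]; ring
  rw [this]
  field_simp
  ring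

variable (x) in
/-- The residual sum of squares of the least-squares fit to the first `l` observations. -/
noncomputable def residualSumSq (l : ℕ) (y : ℕ → ℝ) : ℝ :=
  ∑ i ∈ Finset.range l, (y i - extendedVec (x i) ⬝ᵥ leastSquaresPrefix x l y) ^ 2

/-- After expansion of the square, the normal equations identify the quadratic term with half of the
cross term. -/
theorem HasFullRank.residualSumSq_eq (hx : HasFullRank x) {l : ℕ} (hl : K + 1 ≤ l)
    (y : ℕ → ℝ) :
    residualSumSq x l y = ∑ i ∈ Finset.range l, y i ^ 2 -
      (∑ i ∈ Finset.range l, y i • extendedVec (x i)) ⬝ᵥ leastSquaresPrefix x l y := by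
  have h1 := gramMatrix_mulVec_dotProduct x l (leastSquaresPrefix x l y)
    (leastSquaresPrefix x l y)
  rw [hx.gramMatrix_mulVec_leastSquaresPrefix hl] at h1
  have h2 : (∑ i ∈ Finset.range l, y i • extendedVec (x i)) ⬝ᵥ leastSquaresPrefix x l y =
      ∑ i ∈ Finset.range l, y i * (extendedVec (x i) ⬝ᵥ leastSquaresPrefix x l y) := by
    rw [sum_dotProduct]
    simp
  have h3 : residualSumSq x l y = ∑ i ∈ Finset.range l, y i ^ 2 -
      2 * ∑ i ∈ Finset.range l, y i * (extendedVec (x i) ⬝ᵥ leastSquaresPrefix x l y) +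
      ∑ i ∈ Finset.range l, (extendedVec (x i) ⬝ᵥ leastSquaresPrefix x l y) *
        (extendedVec (x i) ⬝ᵥ leastSquaresPrefix x l y) := by
    rw [residualSumSq, Finset.mul_sum, ← Finset.sum_sub_distrib, ← Finset.sum_add_distrib]
    exact Finset.sum_congr rfl fun i _ => by ring
  rw [h3, ← h1, ← h2]
  ring

theorem HasFullRank.residualSumSq_succ (hx : HasFullRank x) {l : ℕ} (hl : K + 1 ≤ l)
    (y : ℕ → ℝ) :
    residualSumSq x (l + 1) y = residualSumSq x l y + recursiveResidual x l y ^ 2 := by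
  have hs := hx.predictionVariance_pos hl
  rw [hx.residualSumSq_eq hl, hx.residualSumSq_eq (by omega), hx.leastSquaresPrefix_succ hl,
    recursiveResidual, div_pow, Real.sq_sqrt hs.le, Finset.sum_range_succ, Finset.sum_range_succ]
  have h1 : (∑ i ∈ Finset.range l, y i • extendedVec (x i)) ⬝ᵥ
      ((gramMatrix x l)⁻¹ *ᵥ extendedVec (x l)) =
        leastSquaresPrefix x l y ⬝ᵥ extendedVec (x l) := by
    rw [← dotProduct_gramMatrix_inv_mulVec, leastSquaresPrefix_eq]
  have h2 : extendedVec (x l) ⬝ᵥ ((gramMatrix x l)⁻¹ *ᵥ extendedVec (x l)) =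
    predictionVariance x l - 1 := by rw [predictionVariance]; ring
  rw [add_dotProduct, dotProduct_add, dotProduct_add, dotProduct_smul, dotProduct_smul,
    smul_dotProduct, smul_dotProduct, h1, h2, dotProduct_comm (extendedVec (x l))
    (leastSquaresPrefix x l y)]
  simp only [smul_eq_mul]
  field_simp
  ring

/-- With `K + 1` observations the design matrix is square and invertible, so the fit is exact. -/
theorem HasFullRank.residualSumSq_base (hx : HasFullRank x) (y : ℕ → ℝ) :
    residualSumSq x (K + 1) y = 0 := by
  set Z := designMatrix fun i : Fin (K + 1) => x i with hZ
  have hu : IsUnit Z.det := by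
    rw [← Matrix.isUnit_iff_isUnit_det]
    apply isUnit_of_rank_eq_card
    rw [hx (K + 1), min_self, Fintype.card_fin]
  have hfit : Z *ᵥ leastSquaresPrefix x (K + 1) y = fun i : Fin (K + 1) => y i := by
    rw [leastSquaresPrefix, leastSquares, ← hZ, Matrix.mul_inv_rev, Matrix.mulVec_mulVec,
      Matrix.mulVec_mulVec, Matrix.mul_assoc Z, Matrix.mul_assoc Z⁻¹, Matrix.nonsing_inv_mul _
        (by rwa [Matrix.det_transpose]), Matrix.mul_one, Matrix.mul_nonsing_inv _ hu,
      Matrix.one_mulVec]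
  rw [residualSumSq, Finset.sum_range]
  refine Finset.sum_eq_zero fun i _ => ?_
  rw [← designMatrix_mulVec, ← hZ, hfit, sub_self, zero_pow two_ne_zero]

theorem HasFullRank.residualSumSq_eq_sum (hx : HasFullRank x) (y : ℕ → ℝ) (m : ℕ) :
    residualSumSq x (K + 1 + m) y =
      ∑ j ∈ Finset.range m, recursiveResidual x (K + 1 + j) y ^ 2 := by
  induction m with
  | zero => simpa using hx.residualSumSq_base y
  | succ m ih =>
    rw [Finset.sum_range_succ, ← ih, ← add_assoc, hx.residualSumSq_succ (by omega)]

variable (x) in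
theorem varianceEstimate_eq (l : ℕ) (y : ℕ → ℝ) :
    varianceEstimate (fun i : Fin l => x i) (fun i : Fin l => y i) =
      residualSumSq x l y / ((l : ℝ) - K - 1) := by
  rw [varianceEstimate, residualSumSq, Finset.sum_range, one_div, inv_mul_eq_div]
  simp only [dotProduct, Pi.sub_apply, sq]
  rfl

variable (x) in
/-- The coefficients of the recursive residual `l` as a linear function of the responses. -/
noncomputable def residualCoeff (l i : ℕ) : ℝ :=
  (if i = l then 1 else if i < l then
    -(extendedVec (x i) ⬝ᵥ ((gramMatrix x l)⁻¹ *ᵥ extendedVec (x l))) else 0) /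
      √(predictionVariance x l)

variable (x) in
theorem residualCoeff_of_gt {l i : ℕ} (h : l < i) : residualCoeff x l i = 0 := by
  simp [residualCoeff, h.ne', h.not_gt]

variable (x) in
theorem residualCoeff_of_lt {l i : ℕ} (h : i < l) : residualCoeff x l i =
    -(extendedVec (x i) ⬝ᵥ ((gramMatrix x l)⁻¹ *ᵥ extendedVec (x l))) /
      √(predictionVariance x l) := by
  simp [residualCoeff, h.ne, h]

variable (x) in
theorem residualCoeff_self (l : ℕ) : residualCoeff x l l = 1 / √(predictionVariance x l) := by
  simp [residualCoeff]

variable (x) in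
theorem recursiveResidual_eq_sum (l : ℕ) (y : ℕ → ℝ) :
    recursiveResidual x l y = ∑ i ∈ Finset.range (l + 1), residualCoeff x l i * y i := by
  have h : ∀ i ∈ Finset.range l, residualCoeff x l i * y i =
      -(y i * (extendedVec (x i) ⬝ᵥ ((gramMatrix x l)⁻¹ *ᵥ extendedVec (x l))) /
        √(predictionVariance x l)) := fun i hi => by
    rw [residualCoeff_of_lt x (Finset.mem_range.1 hi)]
    ring
  rw [Finset.sum_range_succ, residualCoeff_self, recursiveResidual, leastSquaresPrefix_eq,
    dotProduct_gramMatrix_inv_mulVec, sum_dotProduct, Finset.sum_congr rfl h,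
    Finset.sum_neg_distrib, ← Finset.sum_div]
  simp_rw [smul_dotProduct, smul_eq_mul]
  ring

/-- This is `G (G⁻¹ z) = z` rearranged: the coefficients are orthogonal to every column of the
design matrix. Both the disappearance of the regression parameters and the orthogonality of
different residuals follow from it. -/
theorem HasFullRank.sum_residualCoeff_smul (hx : HasFullRank x) {l : ℕ} (hl : K + 1 ≤ l) :
    ∑ i ∈ Finset.range (l + 1), residualCoeff x l i • extendedVec (x i) = 0 := by
  have h := gramMatrix_mulVec x l ((gramMatrix x l)⁻¹ *ᵥ extendedVec (x l))
  rw [hx.gramMatrix_mulVec_inv hl] at h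
  rw [Finset.sum_range_succ, residualCoeff_self,
    Finset.sum_congr rfl fun i hi => by rw [residualCoeff_of_lt x (Finset.mem_range.1 hi)]]
  simp_rw [neg_div, neg_smul, Finset.sum_neg_distrib, div_eq_inv_mul, mul_smul, ← Finset.smul_sum]
  rw [← h, one_smul, neg_add_cancel]

theorem HasFullRank.recursiveResidual_linear (hx : HasFullRank x) {l : ℕ} (hl : K + 1 ≤ l)
    (θ : Fin (K + 1) → ℝ) (ξ : ℕ → ℝ) :
    recursiveResidual x l (fun i => extendedVec (x i) ⬝ᵥ θ + ξ i) = recursiveResidual x l ξ := by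
  simp_rw [recursiveResidual_eq_sum, mul_add, Finset.sum_add_distrib]
  have h := congrArg (fun v => v ⬝ᵥ θ) (hx.sum_residualCoeff_smul hl)
  simp only [sum_dotProduct, smul_dotProduct, smul_eq_mul, zero_dotProduct] at h
  rw [h, zero_add]

theorem HasFullRank.sum_residualCoeff_sq (hx : HasFullRank x) {l : ℕ} (hl : K + 1 ≤ l) :
    ∑ i ∈ Finset.range (l + 1), residualCoeff x l i * residualCoeff x l i = 1 := by
  have hs := hx.predictionVariance_pos hl
  rw [Finset.sum_range_succ, residualCoeff_self,
    Finset.sum_congr rfl fun i hi => by rw [residualCoeff_of_lt x (Finset.mem_range.1 hi)]]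
  simp_rw [← sq, div_pow, Real.sq_sqrt hs.le, neg_sq, ← Finset.sum_div]
  rw [hx.sum_sq_extendedVec_dotProduct hl]
  field_simp
  ring

/-- For `i ≤ l < k` the coefficient `residualCoeff x k i` is a fixed linear functional of
`extendedVec (x i)`, so `sum_residualCoeff_smul` annihilates the sum. -/
theorem HasFullRank.sum_residualCoeff_mul (hx : HasFullRank x) {l k : ℕ} (hl : K + 1 ≤ l)
    (hlk : l < k) :
    ∑ i ∈ Finset.range (l + 1), residualCoeff x l i * residualCoeff x k i = 0 := by
  rw [Finset.sum_congr rfl fun i hi => by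
    rw [residualCoeff_of_lt x ((Finset.mem_range_succ_iff.1 hi).trans_lt hlk)]]
  have h := congrArg (fun v => v ⬝ᵥ ((gramMatrix x k)⁻¹ *ᵥ extendedVec (x k)))
    (hx.sum_residualCoeff_smul hl)
  simp only [sum_dotProduct, smul_dotProduct, smul_eq_mul, zero_dotProduct] at h
  simp_rw [← mul_div_assoc, ← Finset.sum_div, mul_neg, Finset.sum_neg_distrib]
  rw [h, neg_zero, zero_div]

end LeastSquares

/-! ### Orthonormal linear images of Gaussian noise. -/

theorem isGaussianProcess_infinitePi_eval (v : ℝ≥0) :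
    IsGaussianProcess (fun (i : ℕ) (ξ : ℕ → ℝ) => ξ i)
      (Measure.infinitePi fun _ : ℕ => gaussianReal 0 v) := by
  have hind : iIndepFun (fun (i : ℕ) (ξ : ℕ → ℝ) => ξ i)
      (Measure.infinitePi fun _ : ℕ => gaussianReal 0 v) :=
    iIndepFun_infinitePi (P := fun _ : ℕ => gaussianReal 0 v) (X := fun _ x => x)
      fun _ => measurable_id
  refine ⟨fun I => (hind.restrict I).hasGaussianLaw fun i => ⟨?_⟩⟩
  change IsGaussian (Measure.map (fun ξ : ℕ → ℝ => ξ i) _)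
  rw [Measure.infinitePi_map_eval]
  infer_instance

theorem covariance_infinitePi_eval (v : ℝ≥0) (i k : ℕ) :
    cov[fun ξ : ℕ → ℝ => ξ i, fun ξ => ξ k; Measure.infinitePi fun _ : ℕ => gaussianReal 0 v] =
      if i = k then (v : ℝ) else 0 := by
  have hind : iIndepFun (fun (i : ℕ) (ξ : ℕ → ℝ) => ξ i)
      (Measure.infinitePi fun _ : ℕ => gaussianReal 0 v) :=
    iIndepFun_infinitePi (P := fun _ : ℕ => gaussianReal 0 v) (X := fun _ x => x)
      fun _ => measurable_id
  have hL2 : ∀ i, MemLp (fun ξ : ℕ → ℝ => ξ i) 2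
      (Measure.infinitePi fun _ : ℕ => gaussianReal 0 v) := fun i =>
    ((isGaussianProcess_infinitePi_eval v).hasGaussianLaw_eval i).memLp_two
  split_ifs with h
  · subst h
    have hm : Measurable fun ξ : ℕ → ℝ => ξ i := measurable_pi_apply i
    rw [covariance_self hm.aemeasurable]
    have := variance_map (μ := Measure.infinitePi fun _ : ℕ => gaussianReal 0 v)
      (X := id) (Y := fun ξ : ℕ → ℝ => ξ i) measurable_id.aemeasurable hm.aemeasurable
    rw [Measure.infinitePi_map_eval, variance_id_gaussianReal] at this
    exact this.symm
  · exact (hind.indepFun h).covariance_eq_zero (hL2 i) (hL2 k)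

theorem integral_infinitePi_eval (v : ℝ≥0) (i : ℕ) :
    ∫ ξ : ℕ → ℝ, ξ i ∂(Measure.infinitePi fun _ : ℕ => gaussianReal 0 v) = 0 := by
  have hm : Measurable fun ξ : ℕ → ℝ => ξ i := measurable_pi_apply i
  have := integral_map (μ := Measure.infinitePi fun _ : ℕ => gaussianReal 0 v)
    hm.aemeasurable (f := fun x : ℝ => x) measurable_id.aestronglyMeasurable
  rw [← this, Measure.infinitePi_map_eval, integral_id_gaussianReal]

/-- Finite linear combinations of IID normal variables with orthonormal coefficients are IID
standard normal. -/
theorem infinitePi_gaussianReal_map_linear {v : ℝ≥0} {N : ℕ → ℕ} {a : ℕ → ℕ → ℝ}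
    (ha : ∀ j i, N j ≤ i → a j i = 0)
    (horth : ∀ j k, j ≤ k →
      (∑ i ∈ Finset.range (N j), a j i * a k i) * v = if j = k then 1 else 0) :
    (Measure.infinitePi fun _ : ℕ => gaussianReal 0 v).map
        (fun ξ j => ∑ i ∈ Finset.range (N j), a j i * ξ i) =
      Measure.infinitePi fun _ : ℕ => gaussianReal 0 1 := by
  set μ := Measure.infinitePi fun _ : ℕ => gaussianReal 0 v with hμ
  set X : ℕ → (ℕ → ℝ) → ℝ := fun j ξ => ∑ i ∈ Finset.range (N j), a j i * ξ i with hX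
  have hproc := isGaussianProcess_infinitePi_eval v
  have hL2 : ∀ i, MemLp (fun ξ : ℕ → ℝ => ξ i) 2 μ := fun i =>
    (hproc.hasGaussianLaw_eval i).memLp_two
  have hXm : ∀ j, Measurable (X j) := fun j => by fun_prop
  have hXproc : IsGaussianProcess X μ := by
    refine hproc.of_isGaussianProcess fun j => ⟨Finset.range (N j),
      ∑ i : Finset.range (N j), a j i • ContinuousLinearMap.proj i, fun ξ => ?_⟩
    simp only [hX, sum_apply, FunLike.coe_smul, Pi.smul_apply,
      ContinuousLinearMap.proj_apply, Finset.restrict, smul_eq_mul]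
    exact (Finset.sum_coe_sort (Finset.range (N j)) fun i => a j i * ξ i).symm
  have hcov : ∀ j k, j ≤ k → cov[X j, X k; μ] = if j = k then 1 else 0 := by
    intro j k hjk
    rw [← horth j k hjk, hX, covariance_fun_sum_fun_sum'
      (fun i _ => (hL2 i).const_mul _) (fun i _ => (hL2 i).const_mul _), Finset.sum_mul]
    refine Finset.sum_congr rfl fun i _ => ?_
    simp_rw [covariance_const_mul_left, covariance_const_mul_right, hμ,
      covariance_infinitePi_eval, mul_ite, mul_zero]
    rw [Finset.sum_ite_eq]
    -- The range `N k` may be shorter than `N j`; in that case `a k i` vanishes on the excess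
    -- indices.
    split_ifs with h
    · ring
    · rw [ha k i (by simpa using h)]
      ring
  have hcov0 : ∀ j k, j ≠ k → cov[X j, X k; μ] = 0 := by
    intro j k hjk
    rcases le_total j k with h | h
    · rw [hcov j k h, if_neg hjk]
    · rw [covariance_comm, hcov k j h, if_neg hjk.symm]
  have hlaw : ∀ j, μ.map (X j) = gaussianReal 0 1 := by
    intro j
    have hint : ∫ ξ, X j ξ ∂μ = 0 := by
      rw [hX, integral_finsetSum _ fun i _ => ((hL2 i).integrable one_le_two).const_mul _]
      refine Finset.sum_eq_zero fun i _ => ?_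
      rw [integral_const_mul, integral_infinitePi_eval, mul_zero]
    rw [(hXproc.hasGaussianLaw_eval j).map_eq_gaussianReal, hint,
      ← covariance_self (hXm j).aemeasurable, hcov j j le_rfl, if_pos rfl, Real.toNNReal_one]
  -- Jointly Gaussian variables that are uncorrelated are independent.
  have hind : iIndepFun X μ := by
    refine iIndepFun_iff_finset.2 fun I =>
      HasGaussianLaw.iIndepFun_of_covariance_eq_zero (hXproc.hasGaussianLaw I) fun i j hij => ?_
    exact hcov0 i j fun h => hij (Subtype.ext h)
  have h := hind.map_fun_eq_infinitePi_map hXm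
  simp_rw [hlaw] at h
  exact h

/-! ### Errors of the classical predictor as exceedances of residuals. -/

section ErrorEvents

variable {K : ℕ}

theorem HasFullRank.map_recursiveResidual {x : ℕ → Fin K → ℝ} (hx : HasFullRank x) {v : ℝ≥0}
    (hv : 0 < v) :
    (Measure.infinitePi fun _ : ℕ => gaussianReal 0 v).map
        (fun ξ j => (√(v : ℝ))⁻¹ * recursiveResidual x (K + 1 + j) ξ) =
      Measure.infinitePi fun _ : ℕ => gaussianReal 0 1 := by
  have hinv : (√(v : ℝ))⁻¹ * (√(v : ℝ))⁻¹ * v = 1 := by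
    rw [← mul_inv, Real.mul_self_sqrt v.coe_nonneg]
    exact inv_mul_cancel₀ (NNReal.coe_ne_zero.2 hv.ne')
  have := infinitePi_gaussianReal_map_linear (v := v) (N := fun j => K + 1 + j + 1)
    (a := fun j i => (√(v : ℝ))⁻¹ * residualCoeff x (K + 1 + j) i)
    (fun j i hi => by rw [residualCoeff_of_gt x (by omega), mul_zero])
    (fun j k hjk => by
      have h : (∑ i ∈ Finset.range (K + 1 + j + 1), (√(v : ℝ))⁻¹ * residualCoeff x (K + 1 + j) i *
          ((√(v : ℝ))⁻¹ * residualCoeff x (K + 1 + k) i)) * v =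
          ∑ i ∈ Finset.range (K + 1 + j + 1),
            residualCoeff x (K + 1 + j) i * residualCoeff x (K + 1 + k) i := by
        rw [Finset.sum_mul]
        refine Finset.sum_congr rfl fun i _ => ?_
        linear_combination
          residualCoeff x (K + 1 + j) i * residualCoeff x (K + 1 + k) i * hinv
      rw [h]
      split_ifs with hjk'
      · subst hjk'
        exact hx.sum_residualCoeff_sq (by omega)
      · exact hx.sum_residualCoeff_mul (by omega) (by omega))
  simp_rw [recursiveResidual_eq_sum, Finset.mul_sum, ← mul_assoc]
  exact this

theorem extendedVec_dotProduct_cons (x : Fin K → ℝ) (α : ℝ) (β : Fin K → ℝ) :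
    extendedVec x ⬝ᵥ Fin.cons α β = α + β ⬝ᵥ x := by
  rw [extendedVec, dotProduct, Fin.sum_univ_succ]
  simp [dotProduct, mul_comm]

/-- In terms of the recursive residuals of the noise, the errors of the classical predictor are
studentized exceedances. -/
theorem HasFullRank.linearObservations_mem_errorEvent {x : ℕ → Fin K → ℝ} (hx : HasFullRank x)
    (α : ℝ) (β : Fin K → ℝ) (ξ : ℕ → ℝ) (ε : ℝ) {c : ℝ} (hc : 0 < c) {n : ℕ+} {m : ℕ}
    (hm : 0 < m) (hn : n.natPred = K + 1 + m) :
    linearObservations α β (x, ξ) ∈ errorEvent (classicalPredictor K) ε n ↔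
      (fun j => c * recursiveResidual x (K + 1 + j) ξ) ∈ studentizedExceedance ε m := by
  set y : ℕ → ℝ := fun i => extendedVec (x i) ⬝ᵥ Fin.cons α β + ξ i with hy
  have hobs : linearObservations α β (x, ξ) = fun i => (x i, y i) := by
    ext i : 1
    simp only [linearObservations, hy, extendedVec_dotProduct_cons]
  have hs : 0 < √(predictionVariance x (K + 1 + m)) :=
    Real.sqrt_pos.2 (hx.predictionVariance_pos (by omega))
  have hres : ∀ j, recursiveResidual x (K + 1 + j) y = recursiveResidual x (K + 1 + j) ξ :=
    fun j => hx.recursiveResidual_linear (by omega) _ ξ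
  have hnum : y (K + 1 + m) - leastSquaresPrefix x (K + 1 + m) y ⬝ᵥ extendedVec (x (K + 1 + m)) =
      recursiveResidual x (K + 1 + m) ξ * √(predictionVariance x (K + 1 + m)) := by
    rw [← hres, recursiveResidual, div_mul_cancel₀ _ hs.ne']
  have hvar : varianceEstimate (fun i : Fin (K + 1 + m) => x i) (fun i => y i) =
      (∑ j ∈ Finset.range m, recursiveResidual x (K + 1 + j) ξ ^ 2) / m := by
    rw [varianceEstimate_eq, hx.residualSumSq_eq_sum]
    simp_rw [hres]
    congr 1
    push_cast
    ring
  -- The factor `c` is immaterial here; it will be `1 / σ`, which makes the residuals standard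
  -- normal.
  rw [show (fun j => c * recursiveResidual x (K + 1 + j) ξ) =
    c • fun j => recursiveResidual x (K + 1 + j) ξ from rfl, smul_mem_studentizedExceedance hc]
  rw [hobs, errorEvent, mem_ofPred_eq, hn, classicalPredictor, if_pos (by omega),
    classicalInterval, mem_ofPred_eq, not_lt]
  change _ * √(predictionVariance x (K + 1 + m)) * √(varianceEstimate _ _) ≤
    |y (K + 1 + m) - leastSquaresPrefix x (K + 1 + m) y ⬝ᵥ extendedVec (x (K + 1 + m))| ↔ _
  -- The factor `√(predictionVariance x (K + 1 + m))` of the interval cancels against the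
  -- normalization of the residual.
  rw [hnum, hvar, abs_mul, abs_of_pos hs, mul_right_comm, mul_le_mul_iff_left₀ hs,
    show K + 1 + m - K - 1 = m by omega]
  rfl

end ErrorEvents

/-! ### Measurability of the least-squares quantities. -/

section Measurability

variable {Ω : Type*} [MeasurableSpace Ω]

theorem measurable_matrix_det {n : Type*} [Fintype n] [DecidableEq n] {A : Ω → Matrix n n ℝ}
    (hA : ∀ i j, Measurable fun ω => A ω i j) : Measurable fun ω => (A ω).det := by
  simp_rw [Matrix.det_apply']
  fun_prop

/-- By the adjugate formula each entry is a product of a determinant and an inverted determinant.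
Since the inverse of zero is zero, singular matrices need no separate treatment. -/
theorem measurable_matrix_inv_apply {n : Type*} [Fintype n] [DecidableEq n]
    {A : Ω → Matrix n n ℝ} (hA : ∀ i j, Measurable fun ω => A ω i j) (i j : n) :
    Measurable fun ω => (A ω)⁻¹ i j := by
  simp_rw [Matrix.inv_def, Ring.inverse_eq_inv', Matrix.smul_apply, Matrix.adjugate_apply,
    smul_eq_mul]
  refine (measurable_matrix_det hA).inv.mul (measurable_matrix_det fun k l => ?_)
  by_cases h : k = j
  · simp [h]
  · simpa [Matrix.updateRow_ne h] using hA k l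

theorem measurable_matrix_mulVec_apply {m n : Type*} [Fintype n] {A : Ω → Matrix m n ℝ}
    {u : Ω → n → ℝ} (hA : ∀ i j, Measurable fun ω => A ω i j)
    (hu : ∀ j, Measurable fun ω => u ω j) (i : m) : Measurable fun ω => (A ω *ᵥ u ω) i :=
  Finset.measurable_sum _ fun j _ => (hA i j).mul (hu j)

theorem measurable_dotProduct {n : Type*} [Fintype n] {u w : Ω → n → ℝ}
    (hu : ∀ j, Measurable fun ω => u ω j) (hw : ∀ j, Measurable fun ω => w ω j) :
    Measurable fun ω => u ω ⬝ᵥ w ω :=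
  Finset.measurable_sum _ fun j _ => (hu j).mul (hw j)

variable {K l : ℕ}

theorem measurable_extendedVec_apply {x : Ω → Fin K → ℝ} (hx : Measurable x) (k : Fin (K + 1)) :
    Measurable fun ω => extendedVec (x ω) k := by
  refine Fin.cases ?_ (fun k => ?_) k
  · exact measurable_const
  · exact (measurable_pi_apply k).comp hx

variable {x : Ω → Fin l → Fin K → ℝ} {y : Ω → Fin l → ℝ}

theorem measurable_designMatrix_apply (hx : Measurable x) (i : Fin l) (k : Fin (K + 1)) :
    Measurable fun ω => designMatrix (x ω) i k :=
  measurable_extendedVec_apply ((measurable_pi_apply i).comp hx) k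

theorem measurable_gram_inv_apply (hx : Measurable x) (i j : Fin (K + 1)) :
    Measurable fun ω => ((designMatrix (x ω))ᵀ * designMatrix (x ω))⁻¹ i j := by
  refine measurable_matrix_inv_apply (fun i j => ?_) i j
  simp only [Matrix.mul_apply, Matrix.transpose_apply]
  exact Finset.measurable_sum _ fun k _ =>
    (measurable_designMatrix_apply hx k i).mul (measurable_designMatrix_apply hx k j)

theorem measurable_leastSquares_apply (hx : Measurable x) (hy : Measurable y) (k : Fin (K + 1)) :
    Measurable fun ω => leastSquares (x ω) (y ω) k :=
  measurable_matrix_mulVec_apply (measurable_gram_inv_apply hx)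
    (measurable_matrix_mulVec_apply (fun i j => measurable_designMatrix_apply hx j i)
      fun j => (measurable_pi_apply j).comp hy) k

theorem measurable_varianceEstimate (hx : Measurable x) (hy : Measurable y) :
    Measurable fun ω => varianceEstimate (x ω) (y ω) := by
  have h : ∀ i, Measurable fun ω =>
      (y ω - designMatrix (x ω) *ᵥ leastSquares (x ω) (y ω)) i := fun i =>
    ((measurable_pi_apply i).comp hy).sub (measurable_matrix_mulVec_apply
      (measurable_designMatrix_apply hx) (measurable_leastSquares_apply hx hy) i)
  exact measurable_const.mul (measurable_dotProduct h h)

theorem measurableSet_mem_classicalInterval (ε : ℝ) {xnew : Ω → Fin K → ℝ} {w : Ω → ℝ}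
    (hx : Measurable x) (hy : Measurable y) (hxnew : Measurable xnew) (hw : Measurable w) :
    MeasurableSet {ω | w ω ∈ classicalInterval ε (x ω) (y ω) (xnew ω)} := by
  have hz := measurable_extendedVec_apply hxnew
  simp only [classicalInterval, mem_ofPred_eq]
  refine measurableSet_lt ?_ ?_
  · exact continuous_abs.measurable.comp
      (hw.sub (measurable_dotProduct (measurable_leastSquares_apply hx hy) hz))
  · exact (measurable_const.mul (measurable_const.add (measurable_dotProduct hz
      (measurable_matrix_mulVec_apply (measurable_gram_inv_apply hx) hz))).sqrt).mul
      (measurable_varianceEstimate hx hy).sqrt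

end Measurability

/-! ### The predictor in the Gauss linear model: validity and independence. -/

theorem isConfidencePredictor_classicalPredictor (K : ℕ) :
    IsConfidencePredictor (classicalPredictor K) where
  measurable m ε _ := by
    unfold classicalPredictor
    split_ifs
    · exact measurableSet_mem_classicalInterval ε (by fun_prop) (by fun_prop) (by fun_prop)
        (by fun_prop)
    · simp
  nested m past x ε₁ h₁ ε₂ h₂ hlt := by
    unfold classicalPredictor
    split_ifs
    · intro w hw
      simp only [classicalInterval, mem_ofPred_eq] at hw ⊢
      refine lt_of_lt_of_le hw ?_
      gcongr
      exact upperPoint_anti _ (by linarith [h₂.1]) (by linarith) (by linarith [h₁.2])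
    · exact subset_rfl

theorem IsConfidencePredictor.measurableSet_errorEvent {K : ℕ} {Γ : PredictionStrategy K}
    (hΓ : IsConfidencePredictor Γ) {ε : ℝ} (hε : ε ∈ Ioo (0 : ℝ) 1) (n : ℕ+) :
    MeasurableSet (errorEvent Γ ε n) := by
  have hm : Measurable fun ζ : ℕ → Observation K =>
      ((fun i : Fin n.natPred => ζ i), (ζ n.natPred).1, (ζ n.natPred).2) := by fun_prop
  exact (hm (hΓ.measurable n.natPred ε hε)).compl

theorem measurable_linearObservations {K : ℕ} (α : ℝ) (β : Fin K → ℝ) :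
    Measurable (linearObservations α β) := by
  refine measurable_pi_lambda _ fun n => ?_
  have h : Measurable fun p : (ℕ → Fin K → ℝ) × (ℕ → ℝ) => β ⬝ᵥ p.1 n :=
    measurable_dotProduct (fun j => measurable_const) fun j => by fun_prop
  exact Measurable.prodMk (by fun_prop) ((measurable_const.add h).add (by fun_prop))

theorem isProbabilityMeasure_of_mem_gaussLinearModel {K : ℕ} {P : Measure (ℕ → Observation K)}
    (hP : P ∈ gaussLinearModel K) : IsProbabilityMeasure P := by
  obtain ⟨α, β, v, ν, -, _, -, rfl⟩ := hP
  exact Measure.isProbabilityMeasure_map (measurable_linearObservations α β).aemeasurable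

/-- In the Gauss linear model, the classical predictor errs at any `k` given steps with
probability `ε ^ k`. -/
theorem measure_biInter_errorEvent {K : ℕ} {P : Measure (ℕ → Observation K)}
    (hP : P ∈ gaussLinearModel K) {ε : ℝ} (hε : ε ∈ Ioo (0 : ℝ) 1) (s : Finset ℕ+)
    (hs : ∀ n ∈ s, K + 3 ≤ (n : ℕ)) :
    P (⋂ n ∈ s, errorEvent (classicalPredictor K) ε n) = ENNReal.ofReal ε ^ s.card := by
  obtain ⟨α, β, v, ν, hv, _, hν, rfl⟩ := hP
  -- Step `n` uses `n - 1` past observations, hence `m = n - K - 2` residuals; the bound `K + 3 ≤ n`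
  -- is exactly `0 < m`.
  have hpred : ∀ n ∈ s, n.natPred = K + 1 + (n.natPred - (K + 1)) ∧
      0 < n.natPred - (K + 1) := fun n hn => by
    have h1 := hs n hn
    have h2 := n.natPred_add_one
    omega
  have hinj : InjOn (fun n : ℕ+ => n.natPred - (K + 1)) s := fun n hn k hk h => by
    have h1 := (hpred n hn).1
    have h2 := (hpred k hk).1
    exact PNat.natPred_injective (by simp only at h; omega)
  have hm : MeasurableSet (⋂ n ∈ s, errorEvent (classicalPredictor K) ε n) :=
    s.measurableSet_biInter fun n _ =>
      (isConfidencePredictor_classicalPredictor K).measurableSet_errorEvent hε n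
  have hlin := measurable_linearObservations α β
  rw [Measure.map_apply hlin hm, Measure.prod_apply (hlin hm)]
  have hc : 0 < (√(v : ℝ))⁻¹ := inv_pos.2 (Real.sqrt_pos.2 hv)
  -- The conditional probability given the explanatory vectors is the same constant for almost every
  -- `x`, so the law `ν` plays no further role.
  have key : ∀ᵐ x ∂ν, (Measure.infinitePi fun _ : ℕ => gaussianReal 0 v) (Prod.mk x ⁻¹'
      (linearObservations α β ⁻¹' ⋂ n ∈ s, errorEvent (classicalPredictor K) ε n)) =
        ENNReal.ofReal ε ^ s.card := by
    filter_upwards [hν] with x hx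
    set s' := s.image fun n : ℕ+ => n.natPred - (K + 1) with hs'
    have hset : Prod.mk x ⁻¹'
        (linearObservations α β ⁻¹' ⋂ n ∈ s, errorEvent (classicalPredictor K) ε n) =
        (fun ξ j => (√(v : ℝ))⁻¹ * recursiveResidual x (K + 1 + j) ξ) ⁻¹'
          ⋂ m ∈ s', studentizedExceedance ε m := by
      ext ξ
      simp only [mem_preimage, mem_iInter, hs', Finset.mem_image, forall_exists_index, and_imp,
        forall_apply_eq_imp_iff₂]
      exact forall₂_congr fun n hn =>
        hx.linearObservations_mem_errorEvent α β ξ ε hc (hpred n hn).2 (hpred n hn).1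
    have hresm : Measurable fun (ξ : ℕ → ℝ) (j : ℕ) =>
        (√(v : ℝ))⁻¹ * recursiveResidual x (K + 1 + j) ξ := by
      simp_rw [recursiveResidual_eq_sum]
      fun_prop
    rw [hset, ← Measure.map_apply hresm (s'.measurableSet_biInter fun m _ =>
        measurableSet_studentizedExceedance ε m), hx.map_recursiveResidual hv,
      infinitePi_biInter_studentizedExceedance hε.1 hε.2 s', Finset.card_image_of_injOn hinj]
    simp only [hs', Finset.mem_image, forall_exists_index, and_imp, forall_apply_eq_imp_iff₂]
    exact fun n hn => (hpred n hn).2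
  rw [lintegral_congr_ae key, lintegral_const, measure_univ, mul_one]

theorem isWeaklyValidFor_classicalPredictor (K : ℕ) :
    IsWeaklyValidFor (classicalPredictor K) (gaussLinearModel K) {n : ℕ+ | K + 3 ≤ (n : ℕ)} := by
  intro P hP n hn ε hε
  simpa using measure_biInter_errorEvent hP hε {n} (by simpa using hn)

/-- Each event has probability `ε` and any `k` of them meet with probability `ε ^ k`, which is the
product formula. -/
theorem iIndepSet_errorEvent_classicalPredictor {K : ℕ} {P : Measure (ℕ → Observation K)}
    (hP : P ∈ gaussLinearModel K) {ε : ℝ} (hε : ε ∈ Ioo (0 : ℝ) 1) :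
    iIndepSet (fun n : {n : ℕ+ | K + 3 ≤ (n : ℕ)} =>
      errorEvent (classicalPredictor K) ε n) P := by
  have := isProbabilityMeasure_of_mem_gaussLinearModel hP
  rw [iIndepSet_iff_meas_biInter fun n : {n : ℕ+ | K + 3 ≤ (n : ℕ)} =>
    (isConfidencePredictor_classicalPredictor K).measurableSet_errorEvent hε n]
  intro s
  rw [Finset.prod_congr rfl fun (n : {n : ℕ+ | K + 3 ≤ (n : ℕ)}) _ =>
    isWeaklyValidFor_classicalPredictor K P hP n n.2 ε hε, Finset.prod_const]
  have h := measure_biInter_errorEvent hP hε (s.map (Function.Embedding.subtype _)) fun n hn => by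
    obtain ⟨k, -, rfl⟩ := Finset.mem_map.1 hn
    exact k.2
  rw [Finset.card_map] at h
  rw [← h]
  congr 1
  ext ζ
  simp

theorem corollary2 (K : ℕ) :
    (∀ P ∈ gaussLinearModel K, ∀ ε ∈ Ioo (0 : ℝ) 1,
      iIndepSet (fun n : {n : ℕ+ | K + 3 ≤ (n : ℕ)} =>
        errorEvent (classicalPredictor K) ε n) P) ∧
    IsConfidencePredictor (classicalPredictor K) ∧
    IsStronglyValidFor (classicalPredictor K) (gaussLinearModel K)
      {n : ℕ+ | K + 3 ≤ (n : ℕ)} :=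
  ⟨fun _ hP _ hε => iIndepSet_errorEvent_classicalPredictor hP hε,
    isConfidencePredictor_classicalPredictor K, isWeaklyValidFor_classicalPredictor K,
    fun _ hP _ hε => iIndepSet_errorEvent_classicalPredictor hP hε⟩
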